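/- Conventions. All rings are commutative. An ideal is regular if it contains a non-zerodivisor. For an ideal $J$ put $\widetilde J=\bigcup_{n\ge 1}(J^{n}:J^{n-1})$; a regular ideal $J$ is Ratliff-Rush closed if $\widetilde J=J$. An element $a\in I$ is superficial for $I$ if there is an integer $c\ge 1$ such that $(I^{n}:a)\cap I^{c}=I^{n-1}$ for all $n>c$. Let $G=\mathrm{gr}_I(R)=\bigoplus_{n\ge 0}I^n/I^{n+1}$ and $G^+=\bigoplus_{n\ge 1}I^n/I^{n+1}$; the depth of $G$ is the supremum of the lengths of $G$-regular sequences contained in $G^+$. Proposition 2.2. There exist many ideals $I$ all of whose powers are Ratliff-Rush closed, yet for every superficial element $a$ of $I$ some power of $I/(a)$ in $R/(a)$ is not Ratliff-Rush closed. Precisely: (a) Let $R$ be a Noetherian ring and $I$ a regular ideal of $R$ such that $\mathrm{gr}_I(R)$ has depth exactly $1$. Then $I^n$ is Ratliff-Rush closed for every $n\ge 1$, and for every superficial element $a$ of $I$ there is an $n\ge 1$ such that, with $J=I/(a)\subseteq R/(a)$, $\widetilde{J^n}\ne J^n$. (b) Let $F$ be a field and $l\ge 3$. The ideal $I=(X^l,XY^{l-1},Y^l)$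 of $F[X,Y]$ is regular, $\mathrm{gr}_I(F[X,Y])$ has depth exactly $1$, and $I$ satisfies the conclusion of (a). (c) Let $F$ be a field, $d\ge 2$ and $l\ge 3$. The ideal $I$ of $F[X_1,\dots,X_d]$ generated by all monomials of degree $l$ except $X_1^{l-1}X_2$ is regular, $\mathrm{gr}_I(F[X_1,\dots,X_d])$ has depth exactly $1$, and $I$ satisfies the conclusion of (a). -/

import Mathlib

universe u v

/-- A regular ideal: one that contains a non-zerodivisor of the ring. -/
def IsRegularIdeal {R : Type*} [CommRing R] (I : Ideal R) : Prop :=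
  ∃ x ∈ I, x ∈ nonZeroDivisors R

/-- The ideal `⋃ₙ (Iⁿ⁺¹ : Iⁿ)`, which for a regular ideal `I` is its Ratliff-Rush closure. -/
def ratliffRushClosure {R : Type*} [CommRing R] (I : Ideal R) : Ideal R where
  carrier := {x | ∃ n : ℕ, ∀ y ∈ I ^ n, x * y ∈ I ^ (n + 1)}
  zero_mem' := ⟨0, fun y _ => by rw [zero_mul]; exact Ideal.zero_mem _⟩
  add_mem' := by
    have up : ∀ (z : R) (n k : ℕ), (∀ y ∈ I ^ n, z * y ∈ I ^ (n + 1)) →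
        ∀ y ∈ I ^ (n + k), z * y ∈ I ^ (n + k + 1) := by
      intro z n k h y hy
      rw [pow_add] at hy
      refine Submodule.mul_induction_on hy (fun p hp q hq => ?_) (fun p q hp hq => ?_)
      · have h1 := Ideal.mul_mem_mul (h p hp) hq
        rw [← pow_add] at h1
        rwa [← mul_assoc, show n + k + 1 = n + 1 + k by omega]
      · rw [mul_add]
        exact Ideal.add_mem _ hp hq
    rintro a b ⟨n, hn⟩ ⟨m, hm⟩
    refine ⟨n + m, fun y hy => ?_⟩
    rw [add_mul]
    refine Ideal.add_mem _ (up a n m hn y hy) ?_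
    rw [Nat.add_comm n m] at hy ⊢
    exact up b m n hm y hy
  smul_mem' := by
    rintro c x ⟨n, hn⟩
    refine ⟨n, fun y hy => ?_⟩
    rw [smul_eq_mul, mul_assoc]
    exact Ideal.mul_mem_left _ c (hn y hy)

/-- A Ratliff-Rush closed ideal: a regular ideal that equals its Ratliff-Rush closure. -/
def IsRatliffRushClosed {R : Type*} [CommRing R] (I : Ideal R) : Prop :=
  IsRegularIdeal I ∧ ratliffRushClosure I = I

/-- `a ∈ I` is superficial for `I`: for some positive `c`,
`(Iⁿ⁺¹ : a) ∩ Iᶜ = Iⁿ` for all `n ≥ c`. -/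
def IsSuperficial {R : Type*} [CommRing R] (I : Ideal R) (a : R) : Prop :=
  a ∈ I ∧ ∃ c : ℕ, 1 ≤ c ∧ ∀ n : ℕ, c ≤ n → ∀ x : R,
    (a * x ∈ I ^ (n + 1) ∧ x ∈ I ^ c) ↔ x ∈ I ^ n

/-- In the Rees algebra `R[It] = ⨁ₙ Iⁿtⁿ`, the ideal `⨁ₙ Iⁿ⁺¹tⁿ`. -/
def grRelations {R : Type*} [CommRing R] (I : Ideal R) : Ideal (reesAlgebra I) where
  carrier := {f | ∀ n : ℕ, (f : Polynomial R).coeff n ∈ I ^ (n + 1)}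
  zero_mem' := fun n => by simp
  add_mem' := by
    intro f g hf hg n
    simpa using Ideal.add_mem _ (hf n) (hg n)
  smul_mem' := by
    intro c f hf n
    have hc := (mem_reesAlgebra_iff I (c : Polynomial R)).1 c.2
    simp only [smul_eq_mul, MulMemClass.coe_mul, Polynomial.coeff_mul]
    refine Ideal.sum_mem _ fun p hp => ?_
    have h1 := Ideal.mul_mem_mul (hc p.1) (hf p.2)
    rw [← pow_add] at h1
    replace hp : p.1 + p.2 = n := by simpa using hp
    rwa [← hp, add_assoc]

/-- The associated graded ring `gr_I(R) = ⨁ₙ Iⁿ/Iⁿ⁺¹`, as `(⨁ₙ Iⁿtⁿ) / (⨁ₙ Iⁿ⁺¹tⁿ)`. -/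
abbrev AssociatedGraded {R : Type*} [CommRing R] (I : Ideal R) : Type _ :=
  reesAlgebra I ⧸ grRelations I

/-- The irrelevant ideal `⨁_{n ≥ 1} Iⁿ/Iⁿ⁺¹` of the associated graded ring: the image of the
elements of the Rees algebra without constant term. -/
noncomputable def grPlus {R : Type*} [CommRing R] (I : Ideal R) : Ideal (AssociatedGraded I) :=
  (RingHom.ker ((Polynomial.constantCoeff (R := R)).comp
    (reesAlgebra I).val.toRingHom)).map (Ideal.Quotient.mk (grRelations I))

/-- The depth (grade) of a ring `A` with respect to an ideal `J`: the supremum of the lengths of the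
`A`-regular sequences with all terms in `J`. -/
noncomputable def depthAlong {A : Type*} [CommRing A] (J : Ideal A) : ℕ∞ :=
  ⨆ (rs : List A) (_ : RingTheory.Sequence.IsRegular A rs ∧ ∀ r ∈ rs, r ∈ J), (rs.length : ℕ∞)

/-- The depth of the associated graded ring of `I` is exactly one. -/
def GrDepthExactlyOne {R : Type*} [CommRing R] (I : Ideal R) : Prop :=
  depthAlong (A := AssociatedGraded I) (grPlus I) = 1

/-- All powers of `I` are Ratliff-Rush closed, yet for every superficial element `a` of `I` some
power `Jⁿ` of the ideal `J = I/(a)` of `R/(a)` is not: it differs from `⋃ₖ ((Jⁿ)ᵏ⁺¹ : (Jⁿ)ᵏ)`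
(whether or not `J` is a regular ideal). -/
def ClosedPowersNotModSuperficial {R : Type*} [CommRing R] (I : Ideal R) : Prop :=
  (∀ n : ℕ, 1 ≤ n → IsRatliffRushClosed (I ^ n)) ∧
    ∀ a : R, IsSuperficial I a → ∃ n : ℕ, 1 ≤ n ∧
      ratliffRushClosure ((I.map (Ideal.Quotient.mk (Ideal.span {a}))) ^ n) ≠
        (I.map (Ideal.Quotient.mk (Ideal.span {a}))) ^ n

/-- The ideal `(Xˡ, XYˡ⁻¹, Yˡ)` of `F[X, Y]`. -/
noncomputable def threeGenIdeal (F : Type*) [Field F] (l : ℕ) : Ideal (MvPolynomial (Fin 2) F) :=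
  Ideal.span {MvPolynomial.X 0 ^ l, MvPolynomial.X 0 * MvPolynomial.X 1 ^ (l - 1),
    MvPolynomial.X 1 ^ l}

/-- The ideal of `F[X₁, …, X_d]`, `d ≥ 2`, generated by all monomials of degree `l` except
`X₁ˡ⁻¹X₂` (the variables `X₁, X₂` have indices `0, 1`). -/
noncomputable def omitOneMonomialIdeal (F : Type*) [Field F] (d : ℕ) (hd : 2 ≤ d) (l : ℕ) :
    Ideal (MvPolynomial (Fin d) F) :=
  Ideal.span {p | ∃ s : Fin d →₀ ℕ, s.degree = l ∧
    s ≠ Finsupp.single ⟨0, by omega⟩ (l - 1) + Finsupp.single ⟨1, by omega⟩ 1 ∧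
    p = MvPolynomial.monomial s 1}

/-!
Let `G = gr_I(R)`. If `G⁺` contains a non-zerodivisor `g` and `x ∈ Iᵏ` satisfies
`x Iᴺ ⊆ Iᵏ⁺ᴺ⁺¹`, then the class of `x` in degree `k` is annihilated by `gᴺ`, so `x ∈ Iᵏ⁺¹`
(`mem_pow_succ_of_forall_mul_mem`). Raising `k` step by step, this shows that every power of `I` is
Ratliff-Rush closed, and that `(Iⁿ⁺¹ : a) = Iⁿ` for every superficial `a` and every `n`; the latter
says that `at` is a non-zerodivisor of `G`. Suppose now that all powers of `J = I/(a)` equal their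
Ratliff-Rush closures. Then no nonzero element of `G/(at)` is annihilated by `G⁺`
(`mem_span_of_grPlus_mul_mem_span`), so by prime avoidance `G⁺` contains an element `b` regular on
`G/(at)`. Thus `at, b` is a regular sequence, and `G` does not have depth `1`.

For the examples, depth one follows from an explicit `a ∈ I` with `(Iⁿ⁺¹ : a) = Iⁿ` for all `n` and
an element `m` whose class in `G/(at)` is nonzero and annihilated by `G⁺`
(`grDepthExactlyOne_of_socle`). That such a class bounds the length of every regular sequence,
including those that do not start with `at`, is `depthAlong_eq_one`. In both families `a` is the
`l`-th power of the first variable. For `(Xˡ, XYˡ⁻¹, Yˡ)` the class is that of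
`Xˡ⁻¹ Y^((l-1)² - l)` in degree `l - 3`; for the ideal omitting one monomial it is the class of
that monomial in degree `0`. Since the ideals are monomial, everything reduces to describing the
exponents of the monomials in `Iⁿ`: for the second family these are the exponents of degree at least
`ln` other than that of `X₁ˡⁿ⁻¹X₂`.
-/

/-! ### Regular sequences of length at most two -/

lemma two_le_depthAlong {A : Type*} [CommRing A] {J : Ideal A} (hJ : J ≠ ⊤) {a b : A}
    (ha : a ∈ J) (hb : b ∈ J) (hreg : a ∈ nonZeroDivisors A)
    (h : ∀ z, b * z ∈ Ideal.span {a} → z ∈ Ideal.span {a}) : 2 ≤ depthAlong J := by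
  have hmem : ∀ r ∈ [a, b], r ∈ J := by simp [ha, hb]
  have hseq : RingTheory.Sequence.IsRegular A [a, b] := by
    refine ⟨?_, fun htop => hJ ?_⟩
    · rw [RingTheory.Sequence.isWeaklyRegular_cons_iff,
        RingTheory.Sequence.isWeaklyRegular_cons_iff]
      refine ⟨?_, ?_, RingTheory.Sequence.IsWeaklyRegular.nil _ _⟩
      · rw [isSMulRegular_iff_right_eq_zero_of_smul]
        intro x hx
        exact (mem_nonZeroDivisors_iff.1 hreg).1 x hx
      · rw [isSMulRegular_quotient_iff_mem_of_smul_mem]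
        intro x hx
        rw [← Submodule.ideal_span_singleton_smul, smul_eq_mul, Ideal.mul_top] at hx ⊢
        exact h x hx
    · rw [smul_eq_mul, Ideal.mul_top] at htop
      rw [eq_top_iff, htop, Ideal.ofList, Ideal.span_le]
      exact hmem
  exact le_iSup₂_of_le (f := fun (rs : List A)
    (_ : RingTheory.Sequence.IsRegular A rs ∧ ∀ r ∈ rs, r ∈ J) => (rs.length : ℕ∞))
    [a, b] ⟨hseq, hmem⟩ le_rfl

lemma exists_mem_nonZeroDivisors_of_depthAlong_ne_zero {A : Type*} [CommRing A] {J : Ideal A}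
    (h : depthAlong J ≠ 0) : Nontrivial A ∧ ∃ g ∈ J, g ∈ nonZeroDivisors A := by
  by_contra hcon
  refine h (le_antisymm (iSup₂_le ?_) bot_le)
  rintro (_ | ⟨g, rs⟩) ⟨hreg, hmem⟩
  · simp
  refine absurd ⟨?_, g, hmem g (by simp), ?_⟩ hcon
  · by_contra hA
    rw [not_nontrivial_iff_subsingleton] at hA
    exact hreg.top_ne_smul (Subsingleton.elim _ _)
  · have := ((RingTheory.Sequence.isWeaklyRegular_cons_iff A g rs).1 hreg.toIsWeaklyRegular).1
    rw [isSMulRegular_iff_right_eq_zero_of_smul] at this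
    exact mem_nonZeroDivisors_iff_left.2 this

/-- If some `z ∉ (a)` is multiplied into `(a)` by all of `J`, then no regular sequence in `J` is
longer than `a`: for a regular sequence starting with `g`, writing `g * z = a * w` moves the witness
from `a` to `g`, since then `w ∉ (g)` and `J * w ⊆ (g)`. -/
lemma depthAlong_eq_one {A : Type*} [CommRing A] {J : Ideal A} (hJ : J ≠ ⊤) {a z : A}
    (ha : a ∈ J) (hreg : a ∈ nonZeroDivisors A) (hz : z ∉ Ideal.span {a})
    (h : ∀ b ∈ J, b * z ∈ Ideal.span {a}) : depthAlong J = 1 := by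
  rw [mem_nonZeroDivisors_iff_left] at hreg
  apply le_antisymm
  · refine iSup₂_le ?_
    rintro (_ | ⟨g, _ | ⟨b, rs⟩⟩) ⟨hseq, hmem⟩
    · simp
    · simp
    exfalso
    have hweak := hseq.toIsWeaklyRegular
    rw [RingTheory.Sequence.isWeaklyRegular_cons_iff,
      RingTheory.Sequence.isWeaklyRegular_cons_iff,
      isSMulRegular_iff_right_eq_zero_of_smul, isSMulRegular_quotient_iff_mem_of_smul_mem] at hweak
    obtain ⟨hg, hb, -⟩ := hweak
    simp only [← Submodule.ideal_span_singleton_smul, smul_eq_mul, Ideal.mul_top,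
      Ideal.mem_span_singleton'] at hg hb h hz
    obtain ⟨w, hw⟩ := h g (hmem g (by simp))
    obtain ⟨v, hv⟩ := h b (hmem b (by simp))
    obtain ⟨u, hu⟩ := hb w ⟨v, by
      rw [← sub_eq_zero]
      apply hreg
      linear_combination g * hv - b * hw⟩
    refine hz ⟨u, ?_⟩
    rw [← sub_eq_zero]
    apply hg
    linear_combination hw + a * hu
  · refine le_iSup₂_of_le (f := fun (rs : List A)
      (_ : RingTheory.Sequence.IsRegular A rs ∧ ∀ r ∈ rs, r ∈ J) => (rs.length : ℕ∞))
      [a] ⟨⟨?_, fun htop => hJ ?_⟩, by simpa using ha⟩ (by simp)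
    · rw [RingTheory.Sequence.isWeaklyRegular_cons_iff, isSMulRegular_iff_right_eq_zero_of_smul]
      exact ⟨hreg, RingTheory.Sequence.IsWeaklyRegular.nil _ _⟩
    · rw [smul_eq_mul, Ideal.mul_top] at htop
      rw [eq_top_iff, htop, Ideal.ofList, Ideal.span_le]
      simpa using ha

/-- Prime avoidance: if every element of `J` is a zero divisor on `A ⧸ N`, then one nonzero element
of `A ⧸ N` is annihilated by all of `J`. -/
lemma exists_notMem_forall_mul_mem {A : Type*} [CommRing A] [IsNoetherianRing A] {J N : Ideal A}
    (h : ∀ b ∈ J, ∃ z, b * z ∈ N ∧ z ∉ N) : ∃ z ∉ N, ∀ b ∈ J, b * z ∈ N := by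
  have hsub : (J : Set A) ⊆ ⋃ p ∈ associatedPrimes A (A ⧸ N), (p : Set A) := by
    rw [biUnion_associatedPrimes_eq_compl_regular]
    intro b hb hreg
    obtain ⟨z, hz, hzN⟩ := h b hb
    exact hzN ((isSMulRegular_quotient_iff_mem_of_smul_mem N b).1 hreg z hz)
  obtain ⟨p, hp, hJp⟩ := (Ideal.subset_union_prime_finite (associatedPrimes.finite A (A ⧸ N))
    ⊤ ⊤ (fun p hp _ _ => IsAssociatedPrime.isPrime hp)).1 hsub
  obtain ⟨hprime, x, rfl⟩ := isAssociatedPrime_iff.1 (AssociatedPrimes.mem_iff.1 hp)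
  obtain ⟨z, rfl⟩ := Ideal.Quotient.mk_surjective x
  have key : ∀ b, b ∈ (⊥ : Submodule A (A ⧸ N)).colon {Ideal.Quotient.mk N z} ↔ b * z ∈ N := by
    intro b
    rw [Submodule.mem_colon_singleton, Submodule.mem_bot, Algebra.smul_def,
      Ideal.Quotient.algebraMap_eq, ← map_mul, Ideal.Quotient.eq_zero_iff_mem]
  refine ⟨z, fun hz => hprime.ne_top ?_, fun b hb => (key b).1 (hJp hb)⟩
  rw [Ideal.eq_top_iff_one, key, one_mul]
  exact hz

lemma quotient_mk_mem_nonZeroDivisors_iff {A : Type*} [CommRing A] {N : Ideal A} {x : A} :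
    Ideal.Quotient.mk N x ∈ nonZeroDivisors (A ⧸ N) ↔ ∀ z, x * z ∈ N → z ∈ N := by
  rw [mem_nonZeroDivisors_iff_left, Ideal.Quotient.mk_surjective.forall]
  simp only [← map_mul, Ideal.Quotient.eq_zero_iff_mem]

lemma quotient_mk_mem_span_mk_iff {A : Type*} [CommRing A] {N : Ideal A} {x f : A} :
    Ideal.Quotient.mk N f ∈ Ideal.span {Ideal.Quotient.mk N x} ↔ ∃ g, f - x * g ∈ N := by
  rw [Ideal.mem_span_singleton', Ideal.Quotient.mk_surjective.exists]
  refine exists_congr fun g => ?_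
  rw [mul_comm, ← map_mul, eq_comm, Ideal.Quotient.mk_eq_mk_iff_sub_mem]

/-! ### Initial forms in the associated graded ring -/

section Graded

variable {R : Type*} [CommRing R] {I : Ideal R}

/-- The monomial `y tⁿ`, with `y ∈ Iⁿ`, of the Rees algebra. -/
noncomputable def reesMonomial (n : ℕ) {y : R} (hy : y ∈ I ^ n) : reesAlgebra I :=
  ⟨Polynomial.monomial n y, reesAlgebra.monomial_mem.2 hy⟩

/-- The class of `y ∈ Iⁿ` in the degree `n` part `Iⁿ/Iⁿ⁺¹` of the associated graded ring. It is
zero when `y ∈ Iⁿ⁺¹`. -/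
noncomputable def grForm (n : ℕ) {y : R} (hy : y ∈ I ^ n) : AssociatedGraded I :=
  Ideal.Quotient.mk (grRelations I) (reesMonomial n hy)

lemma mem_grRelations {f : reesAlgebra I} :
    f ∈ grRelations I ↔ ∀ n : ℕ, (f : Polynomial R).coeff n ∈ I ^ (n + 1) := Iff.rfl

lemma coeff_reesMonomial_mul_add (n k : ℕ) {y : R} (hy : y ∈ I ^ n) (f : reesAlgebra I) :
    ((reesMonomial n hy * f : reesAlgebra I) : Polynomial R).coeff (k + n) =
      y * (f : Polynomial R).coeff k :=
  Polynomial.coeff_monomial_mul _ _ _ _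

lemma coeff_reesMonomial_mul_of_lt {n k : ℕ} (h : k < n) {y : R} (hy : y ∈ I ^ n)
    (f : reesAlgebra I) :
    ((reesMonomial n hy * f : reesAlgebra I) : Polynomial R).coeff k = 0 := by
  refine Polynomial.X_pow_dvd_iff.1 (Dvd.dvd.mul_right ?_ _) k h
  exact ⟨Polynomial.C y, by rw [mul_comm, Polynomial.C_mul_X_pow_eq_monomial]; rfl⟩

lemma coeff_mem (f : reesAlgebra I) (n : ℕ) : (f : Polynomial R).coeff n ∈ I ^ n :=
  (mem_reesAlgebra_iff I _).1 f.2 n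

lemma mul_mem_pow_add {m n : ℕ} {x y : R} (hx : x ∈ I ^ m) (hy : y ∈ I ^ n) :
    x * y ∈ I ^ (m + n) := pow_add I m n ▸ Ideal.mul_mem_mul hx hy

lemma mem_grPlus {b : AssociatedGraded I} :
    b ∈ grPlus I ↔ ∃ p : reesAlgebra I, (p : Polynomial R).coeff 0 = 0 ∧
      Ideal.Quotient.mk (grRelations I) p = b := by
  rw [grPlus, Ideal.mem_map_iff_of_surjective _ Ideal.Quotient.mk_surjective]
  simp only [RingHom.mem_ker]
  rfl

lemma grForm_mem_grPlus {n : ℕ} (hn : n ≠ 0) {y : R} (hy : y ∈ I ^ n) :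
    grForm n hy ∈ grPlus I :=
  mem_grPlus.2 ⟨reesMonomial n hy, Polynomial.coeff_monomial_of_ne y hn.symm, rfl⟩

lemma grForm_eq_zero_iff {n : ℕ} {y : R} (hy : y ∈ I ^ n) :
    grForm n hy = 0 ↔ y ∈ I ^ (n + 1) := by
  rw [grForm, Ideal.Quotient.eq_zero_iff_mem, mem_grRelations]
  refine ⟨fun h => ?_, fun h k => ?_⟩
  · have := h n
    rwa [reesMonomial, Polynomial.coeff_monomial_same] at this
  · rw [reesMonomial, Polynomial.coeff_monomial]
    split_ifs with hk
    · rwa [← hk]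
    · exact zero_mem _

lemma grPlus_ne_top (hI : I ≠ ⊤) : grPlus I ≠ ⊤ := by
  intro htop
  obtain ⟨p, hp0, hp⟩ := mem_grPlus.1 ((Ideal.eq_top_iff_one _).1 htop)
  rw [← map_one (Ideal.Quotient.mk (grRelations I)), Ideal.Quotient.mk_eq_mk_iff_sub_mem] at hp
  have h := hp 0
  rw [AddSubgroupClass.coe_sub, Polynomial.coeff_sub, hp0] at h
  exact hI ((Ideal.eq_top_iff_one I).2 (by simpa using h))

lemma ne_top_of_nontrivial (h : Nontrivial (AssociatedGraded I)) : I ≠ ⊤ := by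
  rintro rfl
  refine not_subsingleton_iff_nontrivial.2 h (Ideal.Quotient.subsingleton_iff.2 ?_)
  rw [Ideal.eq_top_iff_one, mem_grRelations]
  intro n
  rw [Ideal.top_pow]
  exact Submodule.mem_top

/-- `at ∈ I/I²` is a non-zerodivisor of the associated graded ring if `(Iⁿ⁺¹ : a) = Iⁿ` for all
`n`. -/
lemma grForm_one_mem_nonZeroDivisors {a : R} (ha : a ∈ I ^ 1)
    (h : ∀ (n : ℕ) (x : R), a * x ∈ I ^ (n + 1) → x ∈ I ^ n) :
    grForm 1 ha ∈ nonZeroDivisors (AssociatedGraded I) := by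
  refine quotient_mk_mem_nonZeroDivisors_iff.2 fun f hb n => ?_
  have := hb (n + 1)
  rw [coeff_reesMonomial_mul_add] at this
  exact h (n + 1) _ this

/-- The elements of the Rees algebra whose class lies in the ideal generated by `at`. -/
lemma mk_mem_span_grForm_one {a : R} (ha : a ∈ I ^ 1) {f : reesAlgebra I} :
    Ideal.Quotient.mk (grRelations I) f ∈ Ideal.span {grForm 1 ha} ↔
      (f : Polynomial R).coeff 0 ∈ I ∧ ∀ n, ∃ u ∈ I ^ n,
        (f : Polynomial R).coeff (n + 1) - a * u ∈ I ^ (n + 2) := by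
  refine quotient_mk_mem_span_mk_iff.trans ⟨?_, ?_⟩
  · rintro ⟨g, hb⟩
    refine ⟨?_, fun n => ⟨(g : Polynomial R).coeff n, coeff_mem g n, ?_⟩⟩
    · have := hb 0
      rw [AddSubgroupClass.coe_sub, Polynomial.coeff_sub,
        coeff_reesMonomial_mul_of_lt one_pos] at this
      simpa using this
    · have := hb (n + 1)
      rwa [AddSubgroupClass.coe_sub, Polynomial.coeff_sub, coeff_reesMonomial_mul_add] at this
  · rintro ⟨h0, h⟩
    choose u hu hfu using h
    -- the cofactor `∑ uₙ tⁿ`, cut off at the degree of `f`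
    let g : Polynomial R := ∑ n ∈ Finset.range (f : Polynomial R).natDegree,
      Polynomial.monomial n (u n)
    have hg : ∀ n, g.coeff n = if n < (f : Polynomial R).natDegree then u n else 0 := by
      intro n
      simp [g, Polynomial.coeff_monomial]
    have hgmem : g ∈ reesAlgebra I := by
      refine (mem_reesAlgebra_iff I _).2 fun n => ?_
      rw [hg]
      split_ifs
      · exact hu n
      · exact zero_mem _
    refine ⟨⟨g, hgmem⟩, ?_⟩
    rintro (_ | n)
    · rw [AddSubgroupClass.coe_sub, Polynomial.coeff_sub, coeff_reesMonomial_mul_of_lt one_pos]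
      simpa using h0
    · rw [AddSubgroupClass.coe_sub, Polynomial.coeff_sub, coeff_reesMonomial_mul_add, hg]
      split_ifs with hn
      · exact hfu n
      · rw [Polynomial.coeff_eq_zero_of_natDegree_lt (by omega)]
        simp

/-- If `G⁺` contains a non-zerodivisor `g`, then a class of degree `k` annihilated by all classes of
degree at least `N` is zero, because it is annihilated by `gᴺ`. -/
lemma mem_pow_succ_of_forall_mul_mem {g : AssociatedGraded I} (hg : g ∈ grPlus I)
    (hreg : g ∈ nonZeroDivisors (AssociatedGraded I)) {k N : ℕ} {x : R} (hx : x ∈ I ^ k)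
    (h : ∀ y ∈ I ^ N, x * y ∈ I ^ (k + N + 1)) : x ∈ I ^ (k + 1) := by
  obtain ⟨p, hp0, rfl⟩ := mem_grPlus.1 hg
  have hpow : Ideal.Quotient.mk (grRelations I) (p ^ N) ∈ nonZeroDivisors (AssociatedGraded I) := by
    rw [map_pow]
    exact pow_mem hreg N
  refine (grForm_eq_zero_iff hx).1 (Ideal.Quotient.eq_zero_iff_mem.2
    (quotient_mk_mem_nonZeroDivisors_iff.1 hpow _ ?_))
  rw [mul_comm]
  intro n
  rcases lt_or_ge n k with hn | hn
  · rw [coeff_reesMonomial_mul_of_lt hn]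
    exact zero_mem _
  obtain ⟨j, rfl⟩ := Nat.exists_eq_add_of_le' hn
  rw [coeff_reesMonomial_mul_add]
  rcases lt_or_ge j N with hj | hj
  · have : (Polynomial.X : Polynomial R) ^ N ∣ (p : Polynomial R) ^ N :=
      pow_dvd_pow_of_dvd (Polynomial.X_dvd_iff.2 hp0) N
    rw [SubmonoidClass.coe_pow, Polynomial.X_pow_dvd_iff.1 this j hj, mul_zero]
    exact zero_mem _
  · obtain ⟨i, rfl⟩ := Nat.exists_eq_add_of_le hj
    have hmem := coeff_mem (p ^ N) (N + i)
    rw [pow_add] at hmem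
    refine Submodule.mul_induction_on hmem (fun y hy w hw => ?_) (fun y w hy hw => ?_)
    · rw [← mul_assoc, show N + i + k + 1 = (k + N + 1) + i by omega]
      exact mul_mem_pow_add (h y hy) hw
    · rw [mul_add]
      exact add_mem hy hw

end Graded

/-! ### Positive depth: Ratliff-Rush closed powers and superficial elements -/

section PositiveDepth

variable {R : Type*} [CommRing R] {I : Ideal R}

lemma IsRegularIdeal.pow (h : IsRegularIdeal I) (n : ℕ) : IsRegularIdeal (I ^ n) :=
  let ⟨x, hx, hreg⟩ := h
  ⟨x ^ n, Ideal.pow_mem_pow hx n, pow_mem hreg n⟩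

lemma le_ratliffRushClosure (I : Ideal R) : I ≤ ratliffRushClosure I :=
  fun x hx => ⟨0, fun y _ => by simpa using I.mul_mem_right y hx⟩

lemma ratliffRushClosure_pow_eq {g : AssociatedGraded I} (hg : g ∈ grPlus I)
    (hreg : g ∈ nonZeroDivisors (AssociatedGraded I)) (n : ℕ) :
    ratliffRushClosure (I ^ n) = I ^ n := by
  refine le_antisymm ?_ (le_ratliffRushClosure _)
  rintro x ⟨m, hm⟩
  simp only [← pow_mul] at hm
  have step : ∀ k ≤ n, x ∈ I ^ k := by
    intro k
    induction k with
    | zero => simp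
    | succ k ih =>
      intro hk
      refine mem_pow_succ_of_forall_mul_mem hg hreg (ih (by omega)) (N := n * m) fun y hy => ?_
      exact Ideal.pow_le_pow_right (by rw [mul_add]; omega) (hm y hy)
  exact step n le_rfl

/-- When `gr_I(R)` has positive depth, a superficial element `a` satisfies `(Iⁿ⁺¹ : a) = Iⁿ` for all
`n`. -/
lemma IsSuperficial.mem_pow_of_mul_mem {g : AssociatedGraded I} (hg : g ∈ grPlus I)
    (hreg : g ∈ nonZeroDivisors (AssociatedGraded I)) {a : R} (ha : IsSuperficial I a) (n : ℕ)
    (x : R) (hx : a * x ∈ I ^ (n + 1)) : x ∈ I ^ n := by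
  obtain ⟨-, c, -, hc⟩ := ha
  have step : ∀ k ≤ n, x ∈ I ^ k := by
    intro k
    induction k with
    | zero => simp
    | succ k ih =>
      intro hk
      refine mem_pow_succ_of_forall_mul_mem hg hreg (ih (by omega)) (N := c) fun y hy => ?_
      refine Ideal.pow_le_pow_right (by omega : k + c + 1 ≤ n + c)
        ((hc (n + c) (by omega) (x * y)).1 ⟨?_, Ideal.mul_mem_left _ _ hy⟩)
      rw [← mul_assoc, show n + c + 1 = n + 1 + c by omega]
      exact mul_mem_pow_add hx hy
  exact step n le_rfl

/-! ### The quotient by a superficial element -/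

lemma mk_mem_map_pow_iff {a x : R} {n : ℕ} :
    Ideal.Quotient.mk (Ideal.span {a}) x ∈ (I.map (Ideal.Quotient.mk (Ideal.span {a}))) ^ n ↔
      ∃ v, x - a * v ∈ I ^ n := by
  rw [← Ideal.map_pow, Ideal.mem_map_iff_of_surjective _ Ideal.Quotient.mk_surjective]
  simp only [Ideal.Quotient.mk_eq_mk_iff_sub_mem, Ideal.mem_span_singleton']
  constructor
  · rintro ⟨y, hy, v, hv⟩
    exact ⟨-v, by rwa [show x - a * -v = y by linear_combination hv]⟩
  · rintro ⟨v, hv⟩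
    exact ⟨_, hv, -v, by ring⟩

lemma mem_ratliffRushClosure_pow_succ {k : ℕ} {x : R}
    (h : ∀ y ∈ I, x * y ∈ I ^ (k + 2)) : x ∈ ratliffRushClosure (I ^ (k + 1)) := by
  refine ⟨1, fun y hy => ?_⟩
  rw [pow_one, pow_succ'] at hy
  rw [← pow_mul]
  refine Submodule.mul_induction_on hy (fun p hp q hq => ?_) (fun p q hp hq => ?_)
  · rw [← mul_assoc, show (k + 1) * (1 + 1) = k + 2 + k by omega]
    exact mul_mem_pow_add (h p hp) hq
  · rw [mul_add x]
    exact add_mem hp hq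

/-- If `at` is a non-zerodivisor of `G = gr_I(R)` and all powers of `J = I/(a)` equal their
Ratliff-Rush closures, then no nonzero element of `G/(at)` is annihilated by `G⁺`: a component of
such an element comes from `f ∈ Iᵏ` with `f J ⊆ Jᵏ⁺²`, so `f` lies in the closure of `Jᵏ⁺¹`. -/
lemma mem_span_of_grPlus_mul_mem_span {a : R} (ha : a ∈ I ^ 1)
    (hcolon : ∀ (n : ℕ) (x : R), a * x ∈ I ^ (n + 1) → x ∈ I ^ n)
    (hclosed : ∀ n : ℕ, 1 ≤ n →
      ratliffRushClosure ((I.map (Ideal.Quotient.mk (Ideal.span {a}))) ^ n) =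
        (I.map (Ideal.Quotient.mk (Ideal.span {a}))) ^ n)
    {z : AssociatedGraded I} (hz : ∀ b ∈ grPlus I, b * z ∈ Ideal.span {grForm 1 ha}) :
    z ∈ Ideal.span {grForm 1 ha} := by
  obtain ⟨f, rfl⟩ := Ideal.Quotient.mk_surjective z
  have hprod : ∀ y ∈ I, ∀ k, ∃ u ∈ I ^ k, y * (f : Polynomial R).coeff k - a * u ∈ I ^ (k + 2) := by
    intro y hy k
    have hy1 : y ∈ I ^ 1 := by rwa [pow_one]
    have := hz _ (grForm_mem_grPlus one_ne_zero hy1)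
    obtain ⟨u, hu, hfu⟩ := ((mk_mem_span_grForm_one ha (f := reesMonomial 1 hy1 * f)).1 this).2 k
    rw [coeff_reesMonomial_mul_add] at hfu
    exact ⟨u, hu, hfu⟩
  have hcoeff : ∀ k, ∃ v, (f : Polynomial R).coeff k - a * v ∈ I ^ (k + 1) := by
    intro k
    rw [← mk_mem_map_pow_iff, ← hclosed (k + 1) (by omega)]
    refine mem_ratliffRushClosure_pow_succ fun y hy => ?_
    obtain ⟨w, hw, rfl⟩ :=
      (Ideal.mem_map_iff_of_surjective _ Ideal.Quotient.mk_surjective).1 hy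
    obtain ⟨u, -, hu⟩ := hprod w hw k
    rw [← map_mul, mk_mem_map_pow_iff]
    exact ⟨u, by rwa [mul_comm _ w]⟩
  refine (mk_mem_span_grForm_one ha).2 ⟨?_, fun n => ?_⟩
  · obtain ⟨v, hv⟩ := hcoeff 0
    rw [zero_add, pow_one] at hv
    rw [pow_one] at ha
    exact (Submodule.sub_mem_iff_left _ (I.mul_mem_right v ha)).1 hv
  · obtain ⟨v, hv⟩ := hcoeff (n + 1)
    refine ⟨v, hcolon n v ?_, hv⟩
    have := sub_mem (coeff_mem f (n + 1)) (Ideal.pow_le_pow_right (by omega) hv)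
    rwa [sub_sub_cancel] at this

lemma closedPowersNotModSuperficial_of_grDepthExactlyOne [IsNoetherianRing R]
    (hI : IsRegularIdeal I) (hdepth : GrDepthExactlyOne I) : ClosedPowersNotModSuperficial I := by
  have hd : depthAlong (A := AssociatedGraded I) (grPlus I) = 1 := hdepth
  obtain ⟨hnontriv, g, hg, hreg⟩ := exists_mem_nonZeroDivisors_of_depthAlong_ne_zero
    (A := AssociatedGraded I) (J := grPlus I) (by rw [hd]; exact one_ne_zero)
  refine ⟨fun n _ => ⟨hI.pow n, ratliffRushClosure_pow_eq hg hreg n⟩, fun a ha => ?_⟩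
  by_contra! hclosed
  have hcolon := ha.mem_pow_of_mul_mem hg hreg
  have ha1 : a ∈ I ^ 1 := by simpa using ha.1
  have : ∃ b ∈ grPlus I, ∀ z, b * z ∈ Ideal.span {grForm 1 ha1} →
      z ∈ Ideal.span {grForm 1 ha1} := by
    by_contra! hcon
    obtain ⟨z, hz, hbz⟩ := exists_notMem_forall_mul_mem (A := AssociatedGraded I)
      (J := grPlus I) (N := Ideal.span {grForm 1 ha1}) hcon
    exact hz (mem_span_of_grPlus_mul_mem_span ha1 hcolon hclosed hbz)
  obtain ⟨b, hb, hbz⟩ := this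
  have h2 := two_le_depthAlong (A := AssociatedGraded I) (grPlus_ne_top (ne_top_of_nontrivial hnontriv))
    (grForm_mem_grPlus one_ne_zero ha1) hb (grForm_one_mem_nonZeroDivisors ha1 hcolon) hbz
  rw [hd] at h2
  exact absurd h2 (by norm_num)

/-- A criterion for depth one: `at` is a non-zerodivisor of `G = gr_I(R)` and the class of `m` in
degree `k` is a nonzero element of `G/(at)` annihilated by `G⁺`. -/
lemma grDepthExactlyOne_of_socle (hI : I ≠ ⊤) {a : R} (ha : a ∈ I)
    (hcolon : ∀ (n : ℕ) (x : R), a * x ∈ I ^ (n + 1) → x ∈ I ^ n)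
    {k : ℕ} {m : R} (hm : m ∈ I ^ k) (hm' : m ∉ Ideal.span {a} ⊔ I ^ (k + 1))
    (hsocle : ∀ y ∈ I, y * m ∈ Ideal.span {a} * I ^ k ⊔ I ^ (k + 2)) : GrDepthExactlyOne I := by
  have ha1 : a ∈ I ^ 1 := by rwa [pow_one]
  refine depthAlong_eq_one (a := grForm 1 ha1) (z := grForm k hm) (grPlus_ne_top hI)
    (grForm_mem_grPlus one_ne_zero ha1) (grForm_one_mem_nonZeroDivisors ha1 hcolon) ?_ ?_
  · intro h
    obtain ⟨h0, hsucc⟩ := (mk_mem_span_grForm_one ha1).1 h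
    rw [reesMonomial] at h0 hsucc
    refine hm' ?_
    rcases k with _ | k
    · refine Ideal.mem_sup_right ?_
      rwa [Polynomial.coeff_monomial_same, ← pow_one I] at h0
    · obtain ⟨u, -, hu⟩ := hsucc k
      rw [Polynomial.coeff_monomial_same] at hu
      exact Ideal.mem_span_singleton_sup.2 ⟨u, _, hu, by ring⟩
  · intro b hb
    obtain ⟨p, hp0, rfl⟩ := mem_grPlus.1 hb
    have hmul : ∀ j, ∀ c ∈ I ^ (j + 1), ∃ u ∈ I ^ (k + j), m * c - a * u ∈ I ^ (k + j + 2) := by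
      intro j c hc
      rw [pow_succ'] at hc
      have : c * m ∈ Ideal.span {a} * I ^ (k + j) ⊔ I ^ (k + j + 2) := by
        refine Submodule.mul_induction_on hc (fun y hy w hw => ?_) (fun y w hy hw => ?_)
        · have := Ideal.mul_mem_mul (hsocle y hy) hw
          rwa [Ideal.sup_mul, mul_assoc, ← pow_add, ← pow_add,
            show k + 2 + j = k + j + 2 by omega, mul_right_comm] at this
        · rw [add_mul]
          exact add_mem hy hw
      obtain ⟨s, hs, t, ht, hst⟩ := Submodule.mem_sup.1 this
      obtain ⟨u, hu, rfl⟩ := Ideal.mem_span_singleton_mul.1 hs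
      exact ⟨u, hu, by rwa [show m * c - a * u = t by linear_combination -hst]⟩
    have hcomm : Ideal.Quotient.mk (grRelations I) p * grForm k hm =
        Ideal.Quotient.mk (grRelations I) (reesMonomial k hm * p) := by
      rw [mul_comm (reesMonomial k hm) p, map_mul]
      rfl
    rw [hcomm]
    have hp : ∀ i < k + 1, ((reesMonomial k hm * p : reesAlgebra I) : Polynomial R).coeff i = 0 := by
      intro i hi
      rcases Nat.lt_succ_iff_lt_or_eq.1 hi with hi | rfl
      · exact coeff_reesMonomial_mul_of_lt hi hm p
      · have := coeff_reesMonomial_mul_add i 0 hm p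
        rwa [hp0, mul_zero, zero_add] at this
    refine (mk_mem_span_grForm_one ha1).2 ⟨?_, fun n => ?_⟩
    · rw [hp 0 (by omega)]
      exact zero_mem _
    · rcases lt_or_ge n k with hn | hn
      · exact ⟨0, zero_mem _, by rw [hp _ (by omega)]; simp⟩
      · obtain ⟨j, rfl⟩ := Nat.exists_eq_add_of_le hn
        rw [show k + j + 1 = j + 1 + k by omega, coeff_reesMonomial_mul_add]
        exact hmul j _ (coeff_mem p (j + 1))

end PositiveDepth

/-! ### Monomial ideals -/

section Monomial

open MvPolynomial
open scoped Pointwise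

variable {σ F : Type*} [Field F]

/-- The ideal generated by the monomials with exponents in `S`. -/
noncomputable def monomialIdeal (F : Type*) [Field F] (S : Set (σ →₀ ℕ)) :
    Ideal (MvPolynomial σ F) :=
  Ideal.span ((fun s => monomial s (1 : F)) '' S)

lemma mem_monomialIdeal {S : Set (σ →₀ ℕ)} {f : MvPolynomial σ F} :
    f ∈ monomialIdeal F S ↔ ∀ s ∈ f.support, ∃ t ∈ S, t ≤ s :=
  mem_ideal_span_monomial_image

lemma monomial_mem_monomialIdeal {S : Set (σ →₀ ℕ)} {s : σ →₀ ℕ} :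
    monomial s (1 : F) ∈ monomialIdeal F S ↔ ∃ t ∈ S, t ≤ s := by
  classical
  rw [mem_monomialIdeal, support_monomial, if_neg one_ne_zero]
  simp

lemma monomialIdeal_mul (S T : Set (σ →₀ ℕ)) :
    monomialIdeal F S * monomialIdeal F T = monomialIdeal F (S + T) := by
  rw [monomialIdeal, monomialIdeal, monomialIdeal, Ideal.span_mul_span', ← Set.image2_mul,
    ← Set.image2_add, Set.image_image2, Set.image2_image_left, Set.image2_image_right]
  simp [monomial_mul]

lemma monomialIdeal_pow (S : Set (σ →₀ ℕ)) (n : ℕ) :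
    monomialIdeal F S ^ n = monomialIdeal F (n • S) := by
  induction n with
  | zero => simp [monomialIdeal]
  | succ n ih => rw [pow_succ, ih, monomialIdeal_mul, succ_nsmul]

lemma monomialIdeal_sup (S T : Set (σ →₀ ℕ)) :
    monomialIdeal F S ⊔ monomialIdeal F T = monomialIdeal F (S ∪ T) := by
  rw [monomialIdeal, monomialIdeal, monomialIdeal, ← Ideal.span_union, Set.image_union]

lemma span_singleton_monomial (t : σ →₀ ℕ) :
    Ideal.span {monomial t (1 : F)} = monomialIdeal F {t} := by
  rw [monomialIdeal, Set.image_singleton]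

lemma isRegularIdeal_monomialIdeal {S : Set (σ →₀ ℕ)} {t : σ →₀ ℕ} (ht : t ∈ S) :
    IsRegularIdeal (monomialIdeal F S) :=
  ⟨monomial t 1, monomial_mem_monomialIdeal.2 ⟨t, ht, le_rfl⟩,
    mem_nonZeroDivisors_of_ne_zero (monomial_eq_zero.not.2 one_ne_zero)⟩

/-- The criterion for depth one, for an ideal `I` and elements `a`, `m` that are all monomial. The
function `P n` describes the exponents of the monomials in `Iⁿ`. -/
lemma grDepthExactlyOne_monomialIdeal {S : Set (σ →₀ ℕ)} {P : ℕ → (σ →₀ ℕ) → Prop}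
    (hP : ∀ n s, (∃ t ∈ n • S, t ≤ s) ↔ P n s) {a m : σ →₀ ℕ} {k : ℕ} (haS : a ∈ S)
    (hcolon : ∀ n s, P (n + 1) (a + s) → P n s)
    (hm : P k m) (hm' : ¬ P (k + 1) m) (ham : ¬ a ≤ m)
    (hsocle : ∀ s ∈ S, (∃ r, P k r ∧ s + m = a + r) ∨ P (k + 2) (s + m)) :
    GrDepthExactlyOne (monomialIdeal F S) := by
  have hmono : ∀ n s, monomial s (1 : F) ∈ monomialIdeal F S ^ n ↔ P n s := fun n s => by
    rw [monomialIdeal_pow, monomial_mem_monomialIdeal, hP]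
  refine grDepthExactlyOne_of_socle (a := monomial a 1) (m := monomial m 1) (k := k) ?_ ?_ ?_ ?_
    ?_ ?_
  · intro htop
    exact hm' ((hmono _ _).1 (by rw [htop, Ideal.top_pow]; exact Submodule.mem_top))
  · exact monomial_mem_monomialIdeal.2 ⟨a, haS, le_rfl⟩
  · intro n f hf
    rw [monomialIdeal_pow, mem_monomialIdeal] at hf ⊢
    intro s hs
    rw [hP]
    refine hcolon n s ((hP _ _).1 (hf (a + s) ?_))
    rwa [mem_support_iff, coeff_monomial_mul, one_mul, ← mem_support_iff]
  · exact (hmono k m).2 hm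
  · rw [span_singleton_monomial, monomialIdeal_pow, monomialIdeal_sup, monomial_mem_monomialIdeal]
    rintro ⟨t, rfl | ht, htm⟩
    · exact ham htm
    · exact hm' ((hP _ _).1 ⟨t, ht, htm⟩)
  · intro y hy
    refine Submodule.span_induction ?_ ?_ ?_ ?_ hy
    · rintro _ ⟨s, hs, rfl⟩
      simp only [monomial_mul, mul_one]
      rcases hsocle s hs with ⟨r, hr, hrs⟩ | h
      · rw [hrs]
        refine Ideal.mem_sup_left ?_
        rw [show monomial (a + r) (1 : F) = monomial a 1 * monomial r 1 by simp [monomial_mul]]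
        exact Ideal.mul_mem_mul (Ideal.mem_span_singleton_self _) ((hmono k r).2 hr)
      · exact Ideal.mem_sup_right ((hmono _ _).2 h)
    · rw [zero_mul]
      exact zero_mem _
    · intro x y _ _ hx hy
      rw [add_mul]
      exact add_mem hx hy
    · intro c x _ hx
      rw [smul_eq_mul, mul_assoc]
      exact Ideal.mul_mem_left _ c hx

lemma exists_mem_succ_nsmul_le_iff {S : Set (σ →₀ ℕ)} {n : ℕ} {s : σ →₀ ℕ} :
    (∃ t ∈ (n + 1) • S, t ≤ s) ↔ ∃ t ∈ S, ∃ r, (∃ u ∈ n • S, u ≤ r) ∧ s = r + t := by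
  rw [succ_nsmul]
  constructor
  · rintro ⟨_, ⟨u, hu, t, ht, rfl⟩, hle⟩
    obtain ⟨w, rfl⟩ := exists_add_of_le hle
    exact ⟨t, ht, u + w, ⟨u, hu, le_self_add⟩, by simp only []; abel⟩
  · rintro ⟨t, ht, r, ⟨u, hu, hur⟩, rfl⟩
    exact ⟨u + t, Set.add_mem_add hu ht, add_le_add_left hur t⟩

/-- To describe the exponents of the monomials in the powers of a monomial ideal, it suffices to
describe how a power arises from the preceding one. -/
lemma exists_mem_nsmul_le_iff {S : Set (σ →₀ ℕ)} {P : ℕ → (σ →₀ ℕ) → Prop} (h0 : ∀ s, P 0 s)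
    (hadd : ∀ n, ∀ t ∈ S, ∀ r, P n r → P (n + 1) (r + t))
    (hsub : ∀ n s, P (n + 1) s → ∃ t ∈ S, t ≤ s ∧ P n (s - t)) (n : ℕ) (s : σ →₀ ℕ) :
    (∃ t ∈ n • S, t ≤ s) ↔ P n s := by
  induction n generalizing s with
  | zero => exact ⟨fun _ => h0 s, fun _ => ⟨0, by simp, zero_le⟩⟩
  | succ n ih =>
    rw [exists_mem_succ_nsmul_le_iff]
    simp only [ih]
    constructor
    · rintro ⟨t, ht, r, hr, rfl⟩
      exact hadd n t ht r hr
    · intro hs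
      obtain ⟨t, ht, hle, hr⟩ := hsub n s hs
      exact ⟨t, ht, s - t, hr, (tsub_add_cancel_of_le hle).symm⟩

end Monomial

/-! ### The ideal `(Xˡ, XYˡ⁻¹, Yˡ)` -/

section ThreeGen

open MvPolynomial
open scoped Pointwise

/-- The exponents of `Xˡ`, `XYˡ⁻¹` and `Yˡ`. -/
noncomputable def threeGenExponents (l : ℕ) : Set (Fin 2 →₀ ℕ) :=
  {Finsupp.single 0 l, Finsupp.single 0 1 + Finsupp.single 1 (l - 1), Finsupp.single 1 l}

lemma threeGenIdeal_eq (F : Type*) [Field F] (l : ℕ) :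
    threeGenIdeal F l = monomialIdeal F (threeGenExponents l) := by
  rw [threeGenIdeal, monomialIdeal, threeGenExponents, Set.image_insert_eq, Set.image_insert_eq,
    Set.image_singleton, X_pow_eq_monomial, X_pow_eq_monomial, X_pow_eq_monomial, X, monomial_mul,
    one_mul]

/-- `XⁱYʲ` is a multiple of a product of `n` of the three generators. -/
def IsThreeGenMultiple (l n : ℕ) (s : Fin 2 →₀ ℕ) : Prop :=
  ∃ p q r : ℕ, p + q + r = n ∧ l * p + q ≤ s 0 ∧ (l - 1) * q + l * r ≤ s 1

lemma exists_mem_nsmul_threeGenExponents_le_iff {l : ℕ} (hl : 1 ≤ l) (n : ℕ) (s : Fin 2 →₀ ℕ) :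
    (∃ t ∈ n • threeGenExponents l, t ≤ s) ↔ IsThreeGenMultiple l n s := by
  obtain ⟨m, rfl⟩ := Nat.exists_eq_add_of_le' hl
  refine exists_mem_nsmul_le_iff (P := IsThreeGenMultiple (m + 1)) (fun s => ⟨0, 0, 0, by simp⟩)
    ?_ ?_ n s
  · rintro n t (rfl | rfl | rfl) u ⟨p, q, r, hn, h0, h1⟩
    · refine ⟨p + 1, q, r, by omega, ?_, ?_⟩ <;> simp at h0 h1 ⊢ <;> linarith
    · refine ⟨p, q + 1, r, by omega, ?_, ?_⟩ <;> simp at h0 h1 ⊢ <;> linarith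
    · refine ⟨p, q, r + 1, by omega, ?_, ?_⟩ <;> simp at h0 h1 ⊢ <;> linarith
  · rintro n s ⟨p, q, r, hn, h0, h1⟩
    simp only [Nat.add_sub_cancel] at h1
    rcases p with _ | p
    · rcases q with _ | q
      · obtain rfl : r = n + 1 := by omega
        refine ⟨_, Or.inr (Or.inr rfl), ?_, 0, 0, n, by omega, by simp, ?_⟩
        · simp [Finsupp.le_def, Fin.forall_fin_two]
          linarith [Nat.zero_le ((m + 1) * n)]
        · simp
          apply Nat.le_sub_of_add_le
          linarith
      · refine ⟨_, Or.inr (Or.inl rfl), ?_, 0, q, r, by omega, ?_, ?_⟩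
        · simp [Finsupp.le_def, Fin.forall_fin_two]
          exact ⟨by omega, by linarith [Nat.zero_le (m * q), Nat.zero_le ((m + 1) * r)]⟩
        · simp
          omega
        · simp
          apply Nat.le_sub_of_add_le
          linarith
    · refine ⟨_, Or.inl rfl, ?_, p, q, r, by omega, ?_, ?_⟩
      · simp [Finsupp.le_def, Fin.forall_fin_two]
        linarith [Nat.zero_le ((m + 1) * p)]
      · simp
        apply Nat.le_sub_of_add_le
        linarith
      · simpa using h1

/-- On exponents, `(Iⁿ⁺¹ : Xˡ) = Iⁿ` for `I = (Xˡ, XYˡ⁻¹, Yˡ)`. -/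
lemma IsThreeGenMultiple.of_single_add {l n : ℕ} (hl : 1 ≤ l) {s : Fin 2 →₀ ℕ}
    (h : IsThreeGenMultiple l (n + 1) (Finsupp.single 0 l + s)) : IsThreeGenMultiple l n s := by
  obtain ⟨m, rfl⟩ := Nat.exists_eq_add_of_le' hl
  obtain ⟨p, q, r, hn, h0, h1⟩ := h
  simp at h0 h1
  rcases p with _ | p
  · rcases lt_or_ge q (m + 1) with hq | hq
    · -- fewer than `l` factors `XYˡ⁻¹`: already `Yˡⁿ` divides the monomial
      refine ⟨0, 0, n, by omega, by simp, ?_⟩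
      simp
      nlinarith
    · -- `(XYˡ⁻¹)ˡ = Xˡ (Yˡ)ˡ⁻¹`
      obtain ⟨q, rfl⟩ := Nat.exists_eq_add_of_le hq
      refine ⟨0, q, r + m, by omega, by omega, ?_⟩
      simp
      linarith
  · exact ⟨p, q, r, by omega, by linarith, by simpa using h1⟩

lemma grDepthExactlyOne_threeGenIdeal (F : Type*) [Field F] {l : ℕ} (hl : 3 ≤ l) :
    GrDepthExactlyOne (threeGenIdeal F l) := by
  obtain ⟨m, rfl⟩ := Nat.exists_eq_add_of_le' hl
  rw [threeGenIdeal_eq]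
  -- the class of `Xˡ⁻¹ Y^((l-1)² - l)` in degree `l - 3`
  refine grDepthExactlyOne_monomialIdeal (k := m) (a := Finsupp.single 0 (m + 3))
    (m := Finsupp.single 0 (m + 2) + Finsupp.single 1 (m * m + 3 * m + 1))
    (exists_mem_nsmul_threeGenExponents_le_iff (by omega)) (Or.inl rfl)
    (fun n s => IsThreeGenMultiple.of_single_add (by omega)) ?_ ?_ ?_ ?_
  · exact ⟨0, 0, m, by omega, by simp, by simp; linarith⟩
  · rintro ⟨p, q, r, hn, h0, h1⟩
    simp at h0 h1
    obtain rfl : p = 0 := by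
      by_contra hp
      nlinarith [Nat.pos_of_ne_zero hp]
    obtain rfl : r = m + 1 - q := by omega
    obtain ⟨j, hj⟩ := Nat.exists_eq_add_of_le (show q ≤ m + 1 by omega)
    rw [hj, Nat.add_sub_cancel_left] at h1
    nlinarith
  · intro h
    have := h 0
    simp at this
  · rintro s (rfl | rfl | rfl)
    · exact Or.inl ⟨_, ⟨0, 0, m, by omega, by simp, by simp; linarith⟩, rfl⟩
    · refine Or.inl ⟨Finsupp.single 1 (m * m + 4 * m + 3),
        ⟨0, 0, m, by omega, by simp, by simp; linarith⟩, ?_⟩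
      ext i
      fin_cases i <;> simp <;> ring
    · exact Or.inr ⟨0, m + 2, 0, by omega, by simp, by simp; linarith⟩

end ThreeGen

/-! ### The ideal generated by all but one of the monomials of degree `l` -/

section OmitOne

open MvPolynomial
open scoped Pointwise

variable {σ : Type*} {i j : σ}

lemma apply_add_apply_le_degree (hij : i ≠ j) (s : σ →₀ ℕ) : s i + s j ≤ s.degree := by
  classical
  have h : Finsupp.single i (s i) + Finsupp.single j (s j) ≤ s := by
    intro k
    by_cases hi : i = k
    · subst hi
      simp [hij]
    · by_cases hj : j = k
      · subst hj
        simp [hij]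
      · simp [hi, hj]
  simpa using Finsupp.degree_mono h

lemma eq_of_le_of_degree_eq {s t : σ →₀ ℕ} (h : s ≤ t) (hdeg : s.degree = t.degree) : s = t := by
  obtain ⟨w, rfl⟩ := exists_add_of_le h
  rw [map_add, left_eq_add, Finsupp.degree_eq_zero_iff] at hdeg
  rw [hdeg, add_zero]

/-- The exponents of degree `l` other than that of `Xᵢˡ⁻¹Xⱼ`. -/
def omitOneExponents (i j : σ) (l : ℕ) : Set (σ →₀ ℕ) :=
  {s | s.degree = l ∧ s ≠ Finsupp.single i (l - 1) + Finsupp.single j 1}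

lemma mem_omitOneExponents_iff (hij : i ≠ j) {l : ℕ} (hl : 1 ≤ l) {s : σ →₀ ℕ} :
    s ∈ omitOneExponents i j l ↔ s.degree = l ∧ ¬ (s j = 1 ∧ s i + 1 = l) := by
  classical
  refine and_congr_right fun hs => not_congr ⟨?_, ?_⟩
  · rintro rfl
    simp [hij, hij.symm]
    omega
  · rintro ⟨hj, hi⟩
    refine (eq_of_le_of_degree_eq ?_ ?_).symm
    · intro k
      by_cases hik : i = k
      · subst hik
        simp [hij]
        omega
      · by_cases hjk : j = k
        · subst hjk
          simp [hij, hj]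
        · simp [hik, hjk]
    · simp [-Finsupp.single_tsub, hs]
      omega

lemma omitOneMonomialIdeal_eq (F : Type*) [Field F] (d : ℕ) (hd : 2 ≤ d) (l : ℕ) :
    omitOneMonomialIdeal F d hd l =
      monomialIdeal F (omitOneExponents ⟨0, by omega⟩ ⟨1, by omega⟩ l) := by
  rw [omitOneMonomialIdeal, monomialIdeal]
  congr 1
  ext p
  simp only [omitOneExponents, Set.mem_image, Set.mem_ofPred_eq, and_assoc, eq_comm (a := p)]

/-- The exponents of degree at least `ln` other than that of `Xᵢˡⁿ⁻¹Xⱼ`. -/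
def IsOmitOneMultiple (i j : σ) (l n : ℕ) (s : σ →₀ ℕ) : Prop :=
  l * n ≤ s.degree ∧ (s.degree = l * n → s j = 1 → s i + 1 ≠ l * n)

/-- A generator splits off from every monomial in `Iⁿ⁺¹`. A monomial not divisible by `Xᵢˡ` is split so that the generator carries at most
`Xᵢˡ⁻²`; then neither factor can be an omitted monomial, except in degree `l`. -/
lemma IsOmitOneMultiple.exists_sub (hij : i ≠ j) {l : ℕ} (hl : 3 ≤ l) {n : ℕ} {s : σ →₀ ℕ}
    (h : IsOmitOneMultiple i j l (n + 1) s) :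
    ∃ t ∈ omitOneExponents i j l, t ≤ s ∧ IsOmitOneMultiple i j l n (s - t) := by
  classical
  obtain ⟨hdeg, hbad⟩ := h
  rw [mul_add, mul_one] at hdeg hbad
  have hn : n = 0 ∨ l ≤ l * n := by
    rcases Nat.eq_zero_or_pos n with hn | hn
    · exact Or.inl hn
    · exact Or.inr (Nat.le_mul_of_pos_right l hn)
  have hdegsub : ∀ t ≤ s, (s - t).degree + t.degree = s.degree := fun t ht => by
    rw [← map_add, tsub_add_cancel_of_le ht]
  have hzero : ∀ r : σ →₀ ℕ, IsOmitOneMultiple i j l 0 r := fun r => ⟨by simp, by simp⟩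
  rcases le_or_gt l (s i) with hsi | hsi
  · have hle : Finsupp.single i l ≤ s := Finsupp.single_le_iff.2 hsi
    have h1 := hdegsub _ hle
    refine ⟨_, (mem_omitOneExponents_iff hij (by omega)).2 ⟨Finsupp.degree_single i l, ?_⟩, hle,
      ?_, ?_⟩
    · simp
    · rw [Finsupp.degree_single] at h1
      omega
    · rw [Finsupp.degree_single] at h1
      simp [hij]
      omega
  have herase : s.degree = s i + (s.erase i).degree := by
    conv_lhs => rw [← Finsupp.single_add_erase i s, map_add, Finsupp.degree_single]
  rcases le_or_gt (l - min (s i) (l - 2)) (s.erase i).degree with hrest | hrest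
  · obtain ⟨g, hg, hgdeg⟩ := Finsupp.exists_le_degree_eq _ _ hrest
    have hgi : g i = 0 := by simpa using hg i
    have hle : Finsupp.single i (min (s i) (l - 2)) + g ≤ s := by
      conv_rhs => rw [← Finsupp.single_add_erase i s]
      exact add_le_add (Finsupp.single_le_single.2 (min_le_left _ _)) hg
    have h1 := hdegsub _ hle
    have h2 : (Finsupp.single i (min (s i) (l - 2)) + g).degree = l := by
      rw [map_add, Finsupp.degree_single, hgdeg]
      omega
    refine ⟨_, (mem_omitOneExponents_iff hij (by omega)).2 ⟨h2, ?_⟩, hle, ?_⟩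
    · simp [hgi]
      omega
    · rcases hn with rfl | hn
      · exact hzero _
      · refine ⟨by omega, fun _ _ => ?_⟩
        simp [hgi]
        omega
  · -- now `s` has degree `l` and `s i = l - 1`
    have hn0 : n = 0 := by
      rcases hn with hn | hn <;> omega
    subst hn0
    refine ⟨s, (mem_omitOneExponents_iff hij (by omega)).2 ⟨by omega, ?_⟩, le_rfl, hzero _⟩
    rintro ⟨hj, hi⟩
    exact hbad (by omega) hj (by omega)

lemma exists_mem_nsmul_omitOneExponents_le_iff (hij : i ≠ j) {l : ℕ} (hl : 3 ≤ l) (n : ℕ)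
    (s : σ →₀ ℕ) :
    (∃ t ∈ n • omitOneExponents i j l, t ≤ s) ↔ IsOmitOneMultiple i j l n s := by
  refine exists_mem_nsmul_le_iff (P := IsOmitOneMultiple i j l) (fun s => ⟨by simp, by simp⟩) ?_
    (fun n s h => h.exists_sub hij hl) n s
  rintro n t ht r ⟨hdeg, hbad⟩
  obtain ⟨htdeg, ht'⟩ := (mem_omitOneExponents_iff hij (by omega)).1 ht
  have h1 := apply_add_apply_le_degree hij t
  have h2 := apply_add_apply_le_degree hij r
  refine ⟨by rw [map_add, mul_add]; omega, ?_⟩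
  rw [map_add, mul_add, Finsupp.add_apply, Finsupp.add_apply]
  omega

lemma grDepthExactlyOne_omitOne (F : Type*) [Field F] (hij : i ≠ j) {l : ℕ} (hl : 3 ≤ l) :
    GrDepthExactlyOne (monomialIdeal F (omitOneExponents i j l)) := by
  classical
  -- the class of the omitted monomial in degree `0`
  refine grDepthExactlyOne_monomialIdeal (k := 0) (a := Finsupp.single i l)
    (m := Finsupp.single i (l - 1) + Finsupp.single j 1)
    (exists_mem_nsmul_omitOneExponents_le_iff hij hl) ?_ ?_ ⟨by simp, by simp⟩ ?_ ?_ ?_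
  · rw [mem_omitOneExponents_iff hij (by omega)]
    simp
  · rintro n s ⟨hdeg, hbad⟩
    rw [mul_add, map_add, Finsupp.degree_single] at hdeg hbad
    simp [hij] at hbad
    exact ⟨by omega, by omega⟩
  · rintro ⟨-, hbad⟩
    simp [-Finsupp.single_tsub, hij, hij.symm] at hbad
    omega
  · intro h
    have := h i
    simp [hij.symm] at this
    omega
  · intro s hs
    obtain ⟨hdeg, hs'⟩ := (mem_omitOneExponents_iff hij (by omega)).1 hs
    by_cases h : s = Finsupp.single i l
    · subst h
      exact Or.inl ⟨_, ⟨by simp, by simp⟩, rfl⟩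
    · refine Or.inr ⟨?_, ?_⟩
      · simp [-Finsupp.single_tsub, hdeg]
        omega
      · intro _ _ hi
        simp [hij.symm] at hi
        exact h (eq_of_le_of_degree_eq (Finsupp.single_le_iff.2 (by omega))
          (by rw [Finsupp.degree_single, hdeg])).symm

end OmitOne

/-! ### Closed powers that do not stay closed modulo superficial elements -/

theorem proposition2p2 :
    (∀ (R : Type u) [CommRing R] [IsNoetherianRing R] (I : Ideal R),
      IsRegularIdeal I → GrDepthExactlyOne I → ClosedPowersNotModSuperficial I) ∧
    (∀ (F : Type v) [Field F] (l : ℕ), 3 ≤ l →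
      IsRegularIdeal (threeGenIdeal F l) ∧ GrDepthExactlyOne (threeGenIdeal F l) ∧
        ClosedPowersNotModSuperficial (threeGenIdeal F l)) ∧
    (∀ (F : Type v) [Field F] (d : ℕ) (hd : 2 ≤ d) (l : ℕ), 3 ≤ l →
      IsRegularIdeal (omitOneMonomialIdeal F d hd l) ∧
        GrDepthExactlyOne (omitOneMonomialIdeal F d hd l) ∧
        ClosedPowersNotModSuperficial (omitOneMonomialIdeal F d hd l)) := by
  refine ⟨fun R _ _ I => closedPowersNotModSuperficial_of_grDepthExactlyOne, ?_, ?_⟩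
  · intro F _ l hl
    have hreg : IsRegularIdeal (threeGenIdeal F l) := by
      rw [threeGenIdeal_eq]
      exact isRegularIdeal_monomialIdeal (Or.inl rfl)
    have hdepth := grDepthExactlyOne_threeGenIdeal F hl
    exact ⟨hreg, hdepth, closedPowersNotModSuperficial_of_grDepthExactlyOne hreg hdepth⟩
  · intro F _ d hd l hl
    have hij : (⟨0, by omega⟩ : Fin d) ≠ ⟨1, by omega⟩ := by simp
    have hreg : IsRegularIdeal (omitOneMonomialIdeal F d hd l) := by
      rw [omitOneMonomialIdeal_eq]
      refine isRegularIdeal_monomialIdeal (t := Finsupp.single ⟨0, by omega⟩ l)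
        ((mem_omitOneExponents_iff hij (by omega)).2 ⟨Finsupp.degree_single _ _, by simp⟩)
    have hdepth : GrDepthExactlyOne (omitOneMonomialIdeal F d hd l) := by
      rw [omitOneMonomialIdeal_eq]
      exact grDepthExactlyOne_omitOne F hij hl
    exact ⟨hreg, hdepth, closedPowersNotModSuperficial_of_grDepthExactlyOne hreg hdepth⟩
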